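/- Consider the downlink from a base station (BS) with $M$ antennas to a single-antenna user, assisted by an intelligent reflecting surface (IRS) with $N$ elements. The overall channel is $\hat{\mathbf h}=\mathbf h_{\mathrm d}+\mathbf G\hat{\boldsymbol\Phi}\mathbf h_{\mathrm r}\in\mathbb C^{M}$ with $\hat{\boldsymbol\Phi}=\operatorname{diag}(e^{j(\theta_1+\Delta\theta_1)},\dots,e^{j(\theta_N+\Delta\theta_N)})$, where $\theta_i\in[0,2\pi]$ are the phase shifts and $\Delta\theta_i$ random phase errors. The fading is Rayleigh: $\mathbf h_{\mathrm d}$, $\mathbf G$, $\mathbf h_{\mathrm r}$ and $(\Delta\theta_1,\dots,\Delta\theta_N)$ are mutually independent, the entries of $\mathbf h_{\mathrm d}\in\mathbb C^{M}$, $\mathbf G\in\mathbb C^{M\times N}$, $\mathbf h_{\mathrm r}\in\mathbb C^{N}$ are i.i.d. $\mathcal{CN}(0,\beta_d)$, $\mathcal{CN}(0,\beta_g)$, $\mathcal{CN}(0,\beta_h)$, with $\beta_d\ge 0$ and $\beta_g,\beta_h>0$ (so $\mathbf G\mathbf h_{\mathrm r}$ has covariance $N\beta_g\beta_h\mathbf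 I$), and the joint law of the phase errors is arbitrary. Let $\mathcal H=(\mathbf h_{\mathrm d},\mathbf G,\mathbf h_{\mathrm r},\Delta\theta)$ be the channel state. With impairment levels $\kappa_b\ge 0$ at the BS and $\kappa_u>0$ at the user, the user receives $$y=\hat{\mathbf h}^{\mathrm H}(\boldsymbol x+\boldsymbol\eta_b)+\eta_u+n,$$ where the transmitted signal $\boldsymbol x$ has power $\mathbb E\{\boldsymbol x^{\mathrm H}\boldsymbol x\}=p_b>0$, and the distortion noises $\boldsymbol\eta_b\sim\mathcal{CN}(\mathbf 0,\boldsymbol\Upsilon_{\mathrm B})$, $\eta_u\sim\mathcal{CN}(0,v_u)$ and the receiver noise $n\sim\mathcal{CN}(0,\sigma_u^2)$, $\sigma_u^2>0$, are, for each channel realization, independent of each other and of $\boldsymbol x$, with $\boldsymbol\Upsilon_{\mathrm B}=\kappa_b\operatorname{diag}(\mathbb E\{\boldsymbol x\boldsymbol x^{\mathrm H}\})$ and $v_u=\kappa_u\hat{\mathbf h}^{\mathrm H}(\mathbb E\{\boldsymbol x\boldsymbol x^{\mathrm H}\}+\boldsymbol\Upsilon_{\mathrm B})\hat{\mathbf h}$.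 Let the BS have channel state information (CSI) $\mathcal H_b$, a random variable jointly distributed with $\mathcal H$ in an arbitrary way. With $\tau_d>0$ the downlink data transmission period and $\tau>0$ the coherence period, the downlink capacity (in bits) is $$C_d=\frac{\tau_d}{\tau}\,\mathbb E_{\mathcal H_b}\Bigl\{\sup_{f(\boldsymbol x|\mathcal H_b),\,\boldsymbol\theta}\mathbb E\bigl\{\mathcal I(\boldsymbol x;y\,|\,\mathcal H,\mathcal H_b)\,\big|\,\mathcal H_b\bigr\}\Bigr\},$$ where $\mathcal I(\boldsymbol x;y\,|\,\mathcal H,\mathcal H_b)$ is the mutual information of $\boldsymbol x$ and $y$ for the given realizations of $\mathcal H$ and $\mathcal H_b$, and the supremum is over all laws $f(\boldsymbol x|\mathcal H_b)$ of $\boldsymbol x$ of power $p_b$ and all phase shifts $\boldsymbol\theta\in[0,2\pi]^N$, both chosen on the basis of $\mathcal H_b$. All of $\kappa_b,\kappa_u,\sigma_u,p_b,\tau_d,\tau,\beta_d,\beta_g,\beta_h$ are fixed. **Theorem.** As $M,N\to\infty$ jointly, $$\frac{\tau_d}{\tau}\log_2\Bigl(1+\frac{1}{\kappa_b+\kappa_u(1+\kappa_b)}\Bigr)\le\liminf_{M,N\to\infty}C_d\le\limsup_{M,N\to\infty}C_d\le\frac{\tau_d}{\tau}\log_2\Bigl(1+\frac1{\kappa_u}\Bigr),$$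 so that the limit of $C_d$ lies between the two bounds whenever it exists. If the BS has perfect CSI for all $M,N$ (that is, $\mathcal H$ is a measurable function of $\mathcal H_b$), then the limit $C_d^{M,N}(\infty)=\lim_{M,N\to\infty}C_d$ exists, is finite, and lies between these two bounds. -/

import Mathlib

open MeasureTheory ProbabilityTheory Filter Topology

noncomputable section

/-- The circularly symmetric complex Gaussian law `CN(0, v)` on `ℂ`: real and imaginary parts are
independent centred real Gaussians of variance `v / 2`. -/
def complexGaussian (v : ℝ) : Measure ℂ :=
  ((gaussianReal 0 (v / 2).toNNReal).prod (gaussianReal 0 (v / 2).toNNReal)).map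
    (fun p : ℝ × ℝ => (⟨p.1, p.2⟩ : ℂ))

/-- The law `CN(0, diag(v₁, …, vₙ))` of a vector with independent coordinates. -/
def complexGaussianVec {n : ℕ} (v : Fin n → ℝ) : Measure (Fin n → ℂ) :=
  Measure.pi fun i => complexGaussian (v i)

/-- A channel state: the direct channel `h_d`, the BS-IRS channel `G`, the IRS-user channel `h_r`,
and the phase errors `Δθ` of the reflecting elements. -/
abbrev ChannelState (M N : ℕ) : Type :=
  (Fin M → ℂ) × (Fin M → Fin N → ℂ) × (Fin N → ℂ) × (Fin N → ℝ)

instance (M N : ℕ) : StandardBorelSpace (ChannelState M N) :=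
  have h1 : StandardBorelSpace ((Fin N → ℂ) × (Fin N → ℝ)) := inferInstance
  have h2 : StandardBorelSpace ((Fin M → Fin N → ℂ) × (Fin N → ℂ) × (Fin N → ℝ)) :=
    StandardBorelSpace.prod
  StandardBorelSpace.prod

/-- Rayleigh fading: `h_d`, `G`, `h_r` and the phase errors are mutually independent, the entries of
the first three are i.i.d. `CN(0, βd)`, `CN(0, βg)`, `CN(0, βh)`, and the phase errors have joint
law `ν`. In particular `G h_r` has covariance matrix `N βg βh I`. -/
def rayleighLaw (M N : ℕ) (βd βg βh : ℝ) (ν : Measure (Fin N → ℝ)) :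
    Measure (ChannelState M N) :=
  (complexGaussianVec fun _ => βd).prod
    ((Measure.pi fun _ : Fin M => complexGaussianVec fun _ : Fin N => βg).prod
      ((complexGaussianVec fun _ => βh).prod ν))

/-- The overall channel `ĥ = h_d + G Φ̂ h_r`, `Φ̂ = diag(exp(j(θ₁ + Δθ₁)), …)`, when the IRS applies
the phase shifts `θ`. -/
def overallChannel {M N : ℕ} (H : ChannelState M N) (θ : Fin N → ℝ) : Fin M → ℂ :=
  H.1 + (Matrix.of H.2.1 * Matrix.diagonal
    fun j => Complex.exp (Complex.I * ((θ j + H.2.2.2 j : ℝ) : ℂ))).mulVec H.2.2.1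

/-- The matrix `E{x xᴴ}` of a transmitted signal `x` with law `P`. -/
def signalMatrix {M : ℕ} (P : Measure (Fin M → ℂ)) : Matrix (Fin M) (Fin M) ℂ :=
  fun i k => ∫ x, x i * star (x k) ∂P

/-- The downlink covariance `Υ_B = κ_b diag(E{x xᴴ})` of the distortion noise at the BS. -/
def distortionMatrix {M : ℕ} (κb : ℝ) (P : Measure (Fin M → ℂ)) : Matrix (Fin M) (Fin M) ℂ :=
  (κb : ℂ) • Matrix.diagonal fun i => signalMatrix P i i

/-- The downlink variance `v_u = κ_u ĥᴴ (E{x xᴴ} + Υ_B) ĥ` of the distortion noise at the user,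
for the channel realization `h`. -/
def distortionVariance {M : ℕ} (κb κu : ℝ) (h : Fin M → ℂ) (P : Measure (Fin M → ℂ)) : ℝ :=
  κu * (star h ⬝ᵥ (signalMatrix P + distortionMatrix κb P).mulVec h).re

/-- The joint law of transmitted signal and received signal `(x, y)`,
`y = ĥᴴ (x + η_b) + η_u + n`, for the channel realization `h` and a signal `x` of law `P`;
`x`, `η_b ~ CN(0, Υ_B)`, `η_u ~ CN(0, v_u)`, `n ~ CN(0, σ²)` are mutually independent. -/
def downlinkLaw {M : ℕ} (κb κu σ : ℝ) (h : Fin M → ℂ) (P : Measure (Fin M → ℂ)) :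
    Measure ((Fin M → ℂ) × ℂ) :=
  (P.prod ((complexGaussianVec fun i => (distortionMatrix κb P i i).re).prod
    ((complexGaussian (distortionVariance κb κu h P)).prod (complexGaussian (σ ^ 2))))).map
    fun t => (t.1, star h ⬝ᵥ (t.1 + t.2.1) + t.2.2.1 + t.2.2.2)

/-- Mutual information, in bits, of a pair with joint law `ρ`. -/
def mutualInfoBits {X Y : Type*} [MeasurableSpace X] [MeasurableSpace Y]
    (ρ : Measure (X × Y)) : ENNReal :=
  InformationTheory.klDiv ρ (ρ.fst.prod ρ.snd) / ENNReal.ofReal (Real.log 2)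

/-- `P` is the law of a signal of transmit power `E{xᴴ x} = p`. -/
def IsSignalLaw {M : ℕ} (p : ℝ) (P : Measure (Fin M → ℂ)) : Prop :=
  IsProbabilityMeasure P ∧ ∫⁻ x, ∑ i, ‖x i‖ₑ ^ 2 ∂P = ENNReal.ofReal p

/-- The downlink capacity `C_d = (τ_d/τ) E{max I(x; y | H, H_b, H_u)}`, in bits per channel use.
`H` is the channel state and `Hb` the channel knowledge of the BS; knowing the value `s` of `Hb`,
one chooses the law `P = f(x | s)` of the signal and the phase shifts `θ` of the IRS so as to
maximize the mutual information averaged over `H` given `Hb = s`. The channel knowledge of the user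
does not show: given `H`, `Hb` and it, the pair `(x, y)` has the law
`downlinkLaw κb κu σ (overallChannel H θ) P`. -/
def downlinkCapacity {M N : ℕ} (κb κu σ p τd τ : ℝ)
    {Ω S : Type*} [MeasurableSpace Ω] [MeasurableSpace S] (μ : Measure Ω) [IsFiniteMeasure μ]
    (H : Ω → ChannelState M N) (Hb : Ω → S) : ENNReal :=
  ENNReal.ofReal (τd / τ) *
    ∫⁻ s, (⨆ (P : Measure (Fin M → ℂ)) (_ : IsSignalLaw p P)
        (θ : Fin N → ℝ) (_ : ∀ j, θ j ∈ Set.Icc 0 (2 * Real.pi)),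
      ∫⁻ c, mutualInfoBits (downlinkLaw κb κu σ (overallChannel c θ) P) ∂(condDistrib H Hb μ s))
      ∂(μ.map Hb)

end

/-! For a fixed channel `h` and signal law `P`, all distortions and noises merge into one Gaussian
independent of the signal, of variance `w = κu s + κb (1 + κu) d + σ²`, where `s` is the received
power and `d` the sum of the per-antenna received powers (`downlinkLaw_eq_gaussianChannelLaw`).
Hence the information is at most `log₂ (1 + s / w)`, with equality when `hᴴ x` is Gaussian. Since `w
≥ κu s`, the upper bound holds for every `M`, `N` and every CSI.

For the lower bounds only `d / s` and `σ² / s` matter. A Gaussian signal on one fixed antenna has `d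
= s` and needs no CSI; as `σ² / s` tends to 0 this gives the lower constant. With perfect CSI,
inverting the channel on `K` antennas gives `d = s / K` (`exists_unit_beam`), so letting `K` grow
reaches the upper constant: the limit under perfect CSI is the upper bound itself.

Both use that any fixed number of antennas have large gain with probability tending to 1
(`tendsto_rayleighLaw_strongStates`). Zero phase shifts suffice: given `h_d`, `h_r` and the phase
errors, each gain is a complex Gaussian whose variance is typically large once `N` is large. -/

/-! ### Circular complex Gaussian laws: stability, density, moments. -/

lemma measurable_complex_mk : Measurable fun p : ℝ × ℝ => (⟨p.1, p.2⟩ : ℂ) :=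
  Complex.measurableEquivRealProd.symm.measurable

instance (v : ℝ) : IsProbabilityMeasure (complexGaussian v) :=
  Measure.isProbabilityMeasure_map measurable_complex_mk.aemeasurable

instance {n : ℕ} (v : Fin n → ℝ) : IsProbabilityMeasure (complexGaussianVec v) := by
  unfold complexGaussianVec; infer_instance

lemma charFun_complexGaussian {v : ℝ} (hv : 0 ≤ v) (t : ℂ) :
    charFun (complexGaussian v) t = Complex.exp (-(v / 4 * ‖t‖ ^ 2 : ℝ)) := by
  rw [charFun_apply, complexGaussian, integral_map measurable_complex_mk.aemeasurable
    (by fun_prop)]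
  have h : ∀ p : ℝ × ℝ, Complex.exp ((inner ℝ (⟨p.1, p.2⟩ : ℂ) t : ℝ) * Complex.I) =
      Complex.exp ((inner ℝ p.1 t.re : ℝ) * Complex.I) *
        Complex.exp ((inner ℝ p.2 t.im : ℝ) * Complex.I) := by
    intro p
    rw [← Complex.exp_add, ← add_mul, ← Complex.ofReal_add]
    congr 3
    simp [Complex.inner]
  simp_rw [h]
  rw [integral_prod_mul (fun x : ℝ => Complex.exp ((inner ℝ x t.re : ℝ) * Complex.I))
    (fun x : ℝ => Complex.exp ((inner ℝ x t.im : ℝ) * Complex.I)), ← charFun_apply,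
    ← charFun_apply, charFun_gaussianReal, charFun_gaussianReal, ← Complex.exp_add]
  congr 1
  rw [← Complex.normSq_eq_norm_sq, Complex.normSq_apply, Real.coe_toNNReal _ (by positivity)]
  push_cast
  ring

lemma complexGaussian_map_const_mul {v : ℝ} (hv : 0 ≤ v) (c : ℂ) :
    (complexGaussian v).map (c * ·) = complexGaussian (‖c‖ ^ 2 * v) := by
  apply Measure.ext_of_charFun
  ext t
  rw [charFun_apply, integral_map (by fun_prop) (by fun_prop)]
  have h : ∀ x : ℂ, inner ℝ (c * x) t = inner ℝ x (star c * t) := by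
    intro x; simp [Complex.inner, mul_left_comm, mul_comm]
  simp_rw [h]
  rw [← charFun_apply, charFun_complexGaussian hv, charFun_complexGaussian (by positivity)]
  simp only [norm_mul, norm_star, mul_pow]
  congr 3
  ring

lemma complexGaussian_conv {v w : ℝ} (hv : 0 ≤ v) (hw : 0 ≤ w) :
    (complexGaussian v).conv (complexGaussian w) = complexGaussian (v + w) := by
  apply Measure.ext_of_charFun
  ext t
  rw [charFun_conv, charFun_complexGaussian hv, charFun_complexGaussian hw,
    charFun_complexGaussian (by positivity), ← Complex.exp_add]
  congr 1; push_cast; ring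

lemma complexGaussian_prod_map_add {v w : ℝ} (hv : 0 ≤ v) (hw : 0 ≤ w) :
    ((complexGaussian v).prod (complexGaussian w)).map (fun p => p.1 + p.2) =
      complexGaussian (v + w) := complexGaussian_conv hv hw

lemma complexGaussianVec_map_sum {n : ℕ} {v : Fin n → ℝ} (hv : ∀ i, 0 ≤ v i) (a : Fin n → ℂ) :
    (complexGaussianVec v).map (fun x => ∑ i, a i * x i) =
      complexGaussian (∑ i, ‖a i‖ ^ 2 * v i) := by
  have h1 : (fun x : Fin n → ℂ => ∑ i, a i * x i) =
      (fun y : Fin n → ℂ => ∑ i, y i) ∘ (fun x i => a i * x i) := rfl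
  rw [h1, ← Measure.map_map (by fun_prop) (by fun_prop), complexGaussianVec,
    Measure.pi_map_pi (f := fun i x => a i * x) (fun i => by fun_prop)]
  simp_rw [complexGaussian_map_const_mul (hv _)]
  apply Measure.ext_of_charFun
  ext t
  rw [charFun_map_sum_pi_eq_prod, Finset.prod_apply,
    charFun_complexGaussian (Finset.sum_nonneg fun i _ => mul_nonneg (by positivity) (hv i))]
  simp_rw [charFun_complexGaussian (mul_nonneg (sq_nonneg ‖a _‖) (hv _))]
  rw [← Complex.exp_sum]
  congr 1
  push_cast
  rw [Finset.sum_div, Finset.sum_mul, Finset.sum_neg_distrib]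

/-- The density of the circularly symmetric complex Gaussian law of variance `v`. -/
noncomputable def complexGaussianPDF (v : ℝ) (z : ℂ) : ℝ :=
  (Real.pi * v)⁻¹ * Real.exp (-(‖z‖ ^ 2 / v))

lemma complexGaussianPDF_pos {v : ℝ} (hv : 0 < v) (z : ℂ) : 0 < complexGaussianPDF v z := by
  unfold complexGaussianPDF; positivity

lemma continuous_complexGaussianPDF (v : ℝ) : Continuous (complexGaussianPDF v) := by
  unfold complexGaussianPDF; fun_prop

lemma complexGaussian_eq_withDensity {v : ℝ} (hv : 0 < v) :
    complexGaussian v =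
      (volume : Measure ℂ).withDensity fun z => ENNReal.ofReal (complexGaussianPDF v z) := by
  have hv' : (v / 2).toNNReal ≠ 0 := by simp [hv]
  have hm : Measurable fun z => ENNReal.ofReal (complexGaussianPDF v z) :=
    (continuous_complexGaussianPDF v).measurable.ennreal_ofReal
  refine Measure.ext_of_lintegral _ fun F hF => ?_
  rw [lintegral_withDensity_eq_lintegral_mul _ hm hF, complexGaussian,
    lintegral_map hF measurable_complex_mk, gaussianReal_of_var_ne_zero _ hv',
    prod_withDensity (by fun_prop) (by fun_prop), ← Measure.volume_eq_prod,
    lintegral_withDensity_eq_lintegral_mul (g := fun p : ℝ × ℝ => F ⟨p.1, p.2⟩) _ (by fun_prop)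
      (hF.comp measurable_complex_mk),
    ← Complex.volume_preserving_equiv_real_prod.symm.lintegral_comp (hm.mul hF)]
  refine lintegral_congr fun p => ?_
  simp only [Pi.mul_apply, Complex.measurableEquivRealProd_symm_apply]
  congr 1
  rw [gaussianPDF, gaussianPDF, ← ENNReal.ofReal_mul (gaussianPDFReal_nonneg _ _ _)]
  congr 1
  rw [gaussianPDFReal, gaussianPDFReal, complexGaussianPDF, mul_mul_mul_comm, ← Real.exp_add,
    ← Complex.normSq_eq_norm_sq, Complex.normSq_apply, Real.coe_toNNReal _ (by positivity),
    ← mul_inv, Real.mul_self_sqrt (by positivity)]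
  congr 2
  · ring
  · simp only
    field_simp
    ring

/-- The density is at most `1 / (π v)` and the disc has area `π r²`; the bound does not depend on
the centre. -/
lemma complexGaussian_ball_le {v : ℝ} (hv : 0 < v) (a : ℂ) {r : ℝ} (hr : 0 ≤ r) :
    complexGaussian v (Metric.ball a r) ≤ ENNReal.ofReal (r ^ 2 / v) := by
  rw [complexGaussian_eq_withDensity hv, withDensity_apply _ measurableSet_ball]
  calc ∫⁻ z in Metric.ball a r, ENNReal.ofReal (complexGaussianPDF v z)
      ≤ ∫⁻ z in Metric.ball a r, ENNReal.ofReal (Real.pi * v)⁻¹ := by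
        refine lintegral_mono fun z => ENNReal.ofReal_le_ofReal ?_
        exact mul_le_of_le_one_right (by positivity) (Real.exp_le_one_iff.2 (by
          have : 0 ≤ ‖z‖ ^ 2 / v := by positivity
          linarith))
    _ = ENNReal.ofReal (r ^ 2 / v) := by
        rw [setLIntegral_const, Complex.volume_ball, ← ENNReal.ofReal_pow hr,
          ← ENNReal.ofReal_coe_nnreal, ← ENNReal.ofReal_mul (by positivity),
          ← ENNReal.ofReal_mul (by positivity), NNReal.coe_real_pi]
        congr 1
        have := Real.pi_pos
        field_simp

/-- The density is positive everywhere, so the nonempty open complement of the closed ball cannot be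
null. -/
lemma complexGaussian_ball_lt_one {v : ℝ} (hv : 0 < v) (r : ℝ) :
    complexGaussian v (Metric.ball 0 r) < 1 := by
  refine lt_of_le_of_ne prob_le_one fun h => ?_
  have hac : (volume : Measure ℂ) ≪ complexGaussian v := by
    rw [complexGaussian_eq_withDensity hv]
    refine withDensity_absolutelyContinuous' (by
      have := continuous_complexGaussianPDF v
      fun_prop) (ae_of_all _ fun z => ?_)
    simpa using complexGaussianPDF_pos hv z
  have h0 : (volume : Measure ℂ) (Metric.closedBall 0 r)ᶜ = 0 :=
    measure_mono_null (Set.compl_subset_compl.2 Metric.ball_subset_closedBall)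
      (hac ((prob_compl_eq_zero_iff measurableSet_ball).2 h))
  refine (Metric.isClosed_closedBall.isOpen_compl.measure_pos volume
    ⟨((|r| + 1 : ℝ) : ℂ), ?_⟩).ne' h0
  have h1 : r < |(|r| + 1)| := (le_abs_self r).trans_lt ((lt_add_one _).trans_le (le_abs_self _))
  simpa only [Set.mem_compl_iff, mem_closedBall_zero_iff, Complex.norm_real, Real.norm_eq_abs,
    not_le] using h1

lemma memLp_id_complexGaussian (v : ℝ) : MemLp id 2 (complexGaussian v) := by
  rw [complexGaussian, memLp_map_measure_iff (by fun_prop) measurable_complex_mk.aemeasurable]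
  have h : (id ∘ fun p : ℝ × ℝ => (⟨p.1, p.2⟩ : ℂ)) =
      fun p => ((p.1 : ℝ) : ℂ) + ((p.2 : ℝ) : ℂ) * Complex.I := by
    ext p; simp [Complex.mk_eq_add_mul_I]
  have h0 : MemLp (fun x : ℝ => (x : ℂ)) 2 (gaussianReal 0 (v / 2).toNNReal) :=
    (memLp_id_gaussianReal 2).ofReal
  rw [h]
  refine MemLp.add (h0.comp_fst _) ?_
  simpa [mul_comm] using (h0.comp_snd (gaussianReal 0 (v / 2).toNNReal)).const_mul Complex.I

lemma integral_id_complexGaussian (v : ℝ) : ∫ z, z ∂complexGaussian v = 0 := by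
  have h : (complexGaussian v).map (fun z => -z) = complexGaussian v := by
    rw [complexGaussian, Measure.map_map (by fun_prop) measurable_complex_mk]
    have h2 : ((fun z : ℂ => -z) ∘ fun p : ℝ × ℝ => (⟨p.1, p.2⟩ : ℂ)) =
      (fun p : ℝ × ℝ => (⟨p.1, p.2⟩ : ℂ)) ∘ (Prod.map (fun x => -x) (fun x => -x)) := by
        funext p; apply Complex.ext <;> simp
    rw [h2, ← Measure.map_map measurable_complex_mk (by fun_prop),
      ← Measure.map_prod_map _ _ (by fun_prop) (by fun_prop), gaussianReal_map_neg, neg_zero]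
  have h3 : ∫ z, z ∂complexGaussian v = -∫ z, z ∂complexGaussian v := by
    conv_lhs => rw [← h, integral_map (by fun_prop) (by fun_prop)]
    exact integral_neg _
  exact self_eq_neg.1 h3

lemma integral_norm_sq_complexGaussian {v : ℝ} (hv : 0 ≤ v) :
    ∫ z, ‖z‖ ^ 2 ∂complexGaussian v = v := by
  rw [complexGaussian, integral_map measurable_complex_mk.aemeasurable (by fun_prop)]
  have h : ∀ p : ℝ × ℝ, ‖(⟨p.1, p.2⟩ : ℂ)‖ ^ 2 = p.1 ^ 2 + p.2 ^ 2 := by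
    intro p; rw [← Complex.normSq_eq_norm_sq, Complex.normSq_apply]; ring
  simp_rw [h]
  have h0 : Integrable (fun x : ℝ => x ^ 2) (gaussianReal 0 (v / 2).toNNReal) :=
    (memLp_id_gaussianReal 2).integrable_sq
  have h1 : ∫ x : ℝ, x ^ 2 ∂(gaussianReal 0 (v / 2).toNNReal) = v / 2 := by
    have := variance_fun_id_gaussianReal (μ := 0) (v := (v / 2).toNNReal)
    rw [variance_eq_integral measurable_id'.aemeasurable] at this
    simpa [integral_id_gaussianReal, Real.coe_toNNReal _ (show 0 ≤ v / 2 by positivity)] using this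
  rw [integral_add (h0.comp_fst _) (h0.comp_snd _),
    integral_fun_fst (fun x : ℝ => x ^ 2), integral_fun_snd (fun x : ℝ => x ^ 2), h1]
  simp

/-! ### Mutual information of an additive Gaussian channel. -/

-- Replacing the output marginal by any other law `q` costs `klDiv ρ.snd q`, by the chain rule. This
-- allows mutual information to be bounded without knowing the output law.
open InformationTheory in
lemma klDiv_fst_prod_snd_le {X Y : Type*} [MeasurableSpace X] [MeasurableSpace Y]
    [StandardBorelSpace X] [Nonempty X] (ρ : Measure (X × Y)) [IsProbabilityMeasure ρ]
    (q : Measure Y) [IsProbabilityMeasure q] :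
    klDiv ρ (ρ.fst.prod ρ.snd) ≤ klDiv ρ (ρ.fst.prod q) := by
  -- The chain rule splits off the first coordinate, so the output is moved there.
  set ρ' : Measure (Y × X) := ρ.map Prod.swap with hρ'
  have : IsProbabilityMeasure ρ' := Measure.isProbabilityMeasure_map (by fun_prop)
  have hfst : ρ'.fst = ρ.snd := Measure.fst_map_swap
  have hback : ρ = ρ'.map Prod.swap := by
    rw [hρ', Measure.map_map measurable_swap measurable_swap, Prod.swap_swap_eq, Measure.map_id]
  have hdis : ρ.snd ⊗ₘ ρ'.condKernel = ρ' := by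
    rw [← hfst]; exact Measure.disintegrate _ _
  have h1 : klDiv ρ (ρ.fst.prod ρ.snd) ≤
      klDiv (ρ.snd ⊗ₘ ρ'.condKernel) (ρ.snd ⊗ₘ Kernel.const Y ρ.fst) := by
    rw [hdis, Measure.compProd_const]
    conv_lhs => rw [← Measure.prod_swap]
    nth_rewrite 1 [hback]
    exact klDiv_map_le _ _ measurable_swap
  have h2 : klDiv (ρ.snd ⊗ₘ ρ'.condKernel) (q ⊗ₘ Kernel.const Y ρ.fst) ≤
      klDiv ρ (ρ.fst.prod q) := by
    rw [hdis, Measure.compProd_const, ← Measure.prod_swap]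
    exact klDiv_map_le _ _ measurable_swap
  refine h1.trans (le_trans ?_ h2)
  rw [klDiv_compProd_eq_add ρ.snd q]
  exact le_add_of_nonneg_left zero_le

/-- The law of `(x, m(x) + z)` where `x` has law `P` and `z ~ CN(0, w)` is independent of `x`. -/
noncomputable def gaussianChannelLaw {X : Type*} [MeasurableSpace X] (P : Measure X) (m : X → ℂ)
    (w : ℝ) : Measure (X × ℂ) :=
  (P.prod (complexGaussian w)).map fun t => (t.1, m t.1 + t.2)

section GaussianChannel

variable {X : Type*} [MeasurableSpace X] {m : X → ℂ}

section

variable {P : Measure X}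

lemma gaussianChannelLaw_isProbabilityMeasure [IsProbabilityMeasure P] (hm : Measurable m) (w : ℝ) :
    IsProbabilityMeasure (gaussianChannelLaw P m w) :=
  Measure.isProbabilityMeasure_map (by fun_prop)

lemma gaussianChannelLaw_fst (hm : Measurable m) (w : ℝ) :
    (gaussianChannelLaw P m w).fst = P := by
  rw [gaussianChannelLaw, Measure.fst, Measure.map_map (by fun_prop) (by fun_prop)]
  exact measurePreserving_fst.map_eq

lemma gaussianChannelLaw_eq_withDensity [SFinite P] (hm : Measurable m) {w u : ℝ}
    (hw : 0 < w) (hu : 0 < u) :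
    gaussianChannelLaw P m w = (P.prod (complexGaussian u)).withDensity
      fun t => ENNReal.ofReal (complexGaussianPDF w (t.2 - m t.1) / complexGaussianPDF u t.2) := by
  have hcw := (continuous_complexGaussianPDF w).measurable
  have hcu := (continuous_complexGaussianPDF u).measurable
  refine Measure.ext_of_lintegral _ fun F hF => ?_
  rw [lintegral_withDensity_eq_lintegral_mul _ (by fun_prop) hF, gaussianChannelLaw,
    lintegral_map hF (by fun_prop), lintegral_prod _ (by fun_prop), lintegral_prod _ (by fun_prop)]
  refine lintegral_congr fun x => ?_
  rw [complexGaussian_eq_withDensity hw, complexGaussian_eq_withDensity hu,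
    lintegral_withDensity_eq_lintegral_mul _ (by fun_prop) (by fun_prop),
    lintegral_withDensity_eq_lintegral_mul _ (by fun_prop) (by fun_prop),
    ← lintegral_sub_right_eq_self _ (m x)]
  refine lintegral_congr fun y => ?_
  simp only [Pi.mul_apply, add_sub_cancel]
  rw [← mul_assoc, ← ENNReal.ofReal_mul (complexGaussianPDF_pos hu _).le,
    mul_div_cancel₀ _ (complexGaussianPDF_pos hu _).ne']

end

variable {P : Measure X} [IsProbabilityMeasure P]

lemma log_complexGaussianPDF_div {w u : ℝ} (hw : 0 < w) (hu : 0 < u) (a b : ℂ) :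
    Real.log (complexGaussianPDF w a / complexGaussianPDF u b) =
      Real.log (u / w) - ‖a‖ ^ 2 / w + ‖b‖ ^ 2 / u := by
  rw [Real.log_div (complexGaussianPDF_pos hw _).ne' (complexGaussianPDF_pos hu _).ne',
    complexGaussianPDF, complexGaussianPDF, Real.log_mul (by positivity) (by positivity),
    Real.log_mul (by positivity) (by positivity), Real.log_exp, Real.log_exp, Real.log_inv,
    Real.log_inv, Real.log_mul (by positivity) hw.ne', Real.log_mul (by positivity) hu.ne',
    Real.log_div hu.ne' hw.ne']
  ring

lemma llr_gaussianChannelLaw (hm : Measurable m) {w u : ℝ} (hw : 0 < w) (hu : 0 < u) :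
    llr (gaussianChannelLaw P m w) (P.prod (complexGaussian u)) =ᵐ[gaussianChannelLaw P m w]
      fun t => Real.log (u / w) - ‖t.2 - m t.1‖ ^ 2 / w + ‖t.2‖ ^ 2 / u := by
  have hcw := (continuous_complexGaussianPDF w).measurable
  have hcu := (continuous_complexGaussianPDF u).measurable
  have hac : gaussianChannelLaw P m w ≪ P.prod (complexGaussian u) := by
    rw [gaussianChannelLaw_eq_withDensity hm hw hu]
    exact withDensity_absolutelyContinuous _ _
  have h := Measure.rnDeriv_withDensity (P.prod (complexGaussian u))
    (f := fun t => ENNReal.ofReal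
      (complexGaussianPDF w (t.2 - m t.1) / complexGaussianPDF u t.2)) (by fun_prop)
  rw [← gaussianChannelLaw_eq_withDensity hm hw hu] at h
  filter_upwards [hac.ae_le h] with t ht
  rw [llr, ht, ENNReal.toReal_ofReal
    (div_pos (complexGaussianPDF_pos hw _) (complexGaussianPDF_pos hu _)).le,
    log_complexGaussianPDF_div hw hu]

lemma integrable_norm_sq_complexGaussian (v : ℝ) :
    Integrable (fun z => ‖z‖ ^ 2) (complexGaussian v) :=
  (memLp_id_complexGaussian v).integrable_norm_pow two_ne_zero

/-- The cross term vanishes because the noise is centred and independent of `m`. -/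
lemma norm_add_sq_prod (hm : MemLp m 2 P) (w : ℝ) :
    Integrable (fun t : X × ℂ => ‖m t.1 + t.2‖ ^ 2) (P.prod (complexGaussian w)) ∧
    (0 ≤ w → ∫ t, ‖m t.1 + t.2‖ ^ 2 ∂(P.prod (complexGaussian w)) = ∫ x, ‖m x‖ ^ 2 ∂P + w) := by
  have h : ∀ t : X × ℂ, ‖m t.1 + t.2‖ ^ 2 =
      ‖m t.1‖ ^ 2 + ‖t.2‖ ^ 2 + 2 * (m t.1 * star t.2).re := by
    intro t
    rw [← Complex.normSq_eq_norm_sq, Complex.normSq_add, Complex.normSq_eq_norm_sq,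
      Complex.normSq_eq_norm_sq]
    rfl
  have h1 : Integrable (fun t : X × ℂ => ‖m t.1‖ ^ 2) (P.prod (complexGaussian w)) :=
    (hm.integrable_norm_pow two_ne_zero).comp_fst _
  have h2 : Integrable (fun t : X × ℂ => ‖t.2‖ ^ 2) (P.prod (complexGaussian w)) :=
    (integrable_norm_sq_complexGaussian w).comp_snd _
  have h3 : Integrable (fun t : X × ℂ => m t.1 * star t.2) (P.prod (complexGaussian w)) :=
    (hm.integrable one_le_two).mul_prod (f := m) (g := fun z : ℂ => star z)
      (Complex.conjCLE.integrable_comp_iff.2 ((memLp_id_complexGaussian w).integrable one_le_two))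
  have h4 : ∫ t, m t.1 * star t.2 ∂(P.prod (complexGaussian w)) = 0 := by
    rw [integral_prod_mul (μ := P) m (fun z : ℂ => star z)]
    have : ∫ z, star z ∂(complexGaussian w) = 0 := by
      have := integral_conj (μ := complexGaussian w) (f := fun z : ℂ => z)
      rw [integral_id_complexGaussian, map_zero] at this
      exact this
    rw [this, mul_zero]
  have h12 : Integrable (fun t : X × ℂ => ‖m t.1‖ ^ 2 + ‖t.2‖ ^ 2)
    (P.prod (complexGaussian w)) := h1.add h2
  have h3' : Integrable (fun t : X × ℂ => 2 * (m t.1 * star t.2).re)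
    (P.prod (complexGaussian w)) := h3.re.const_mul 2
  simp_rw [h]
  refine ⟨h12.add h3', fun hw => ?_⟩
  rw [integral_add h12 h3', integral_add h1 h2, integral_const_mul,
    integral_fun_fst (fun x => ‖m x‖ ^ 2), integral_fun_snd (fun z : ℂ => ‖z‖ ^ 2),
    integral_norm_sq_complexGaussian hw]
  have h5 : ∫ t, (m t.1 * star t.2).re ∂(P.prod (complexGaussian w)) = 0 := by
    have := integral_re h3
    rw [h4] at this
    simpa using this
  rw [h5]
  simp

-- The reference variance equals the total output power, so the two quadratic terms of the
-- log-likelihood ratio have means `-1` and `1` and cancel, whatever the law of `m`.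
open InformationTheory in
lemma klDiv_gaussianChannelLaw (hm : Measurable m) (hm2 : MemLp m 2 P) {w : ℝ} (hw : 0 < w) :
    klDiv (gaussianChannelLaw P m w)
        (P.prod (complexGaussian (∫ x, ‖m x‖ ^ 2 ∂P + w))) =
      ENNReal.ofReal (Real.log (1 + (∫ x, ‖m x‖ ^ 2 ∂P) / w)) := by
  set s := ∫ x, ‖m x‖ ^ 2 ∂P with hs
  have hs0 : 0 ≤ s := integral_nonneg fun x => by positivity
  have hu : 0 < s + w := by positivity
  have hac : gaussianChannelLaw P m w ≪ P.prod (complexGaussian (s + w)) := by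
    rw [gaussianChannelLaw_eq_withDensity hm hw hu]
    exact withDensity_absolutelyContinuous _ _
  have hllr := llr_gaussianChannelLaw (P := P) hm hw hu
  have hmeas : Measurable fun t : X × ℂ => (t.1, m t.1 + t.2) := by fun_prop
  obtain ⟨hi, hI⟩ := norm_add_sq_prod hm2 w
  have h2 : Integrable (fun t : X × ℂ => ‖t.2‖ ^ 2) (P.prod (complexGaussian w)) :=
    (integrable_norm_sq_complexGaussian w).comp_snd _
  have hi3 : Integrable (fun t : X × ℂ => Real.log ((s + w) / w) - ‖t.2‖ ^ 2 / w)
      (P.prod (complexGaussian w)) := (integrable_const _).sub (h2.div_const w)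
  have hint : Integrable (llr (gaussianChannelLaw P m w) (P.prod (complexGaussian (s + w))))
      (gaussianChannelLaw P m w) := by
    rw [integrable_congr hllr, gaussianChannelLaw,
      integrable_map_measure (by fun_prop) hmeas.aemeasurable]
    refine (hi3.add (hi.div_const (s + w))).congr (ae_of_all _ fun t => ?_)
    simp
  have := gaussianChannelLaw_isProbabilityMeasure (P := P) hm w
  rw [klDiv_of_ac_of_integrable hac hint, integral_congr_ae hllr]
  congr 1
  simp only [probReal_univ, add_sub_cancel_right]
  rw [gaussianChannelLaw, integral_map hmeas.aemeasurable (by fun_prop)]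
  simp only [add_sub_cancel_left]
  rw [integral_add hi3 (hi.div_const (s + w)), integral_sub (integrable_const _) (h2.div_const w),
    integral_div, integral_div, hI hw.le, integral_fun_snd (fun z : ℂ => ‖z‖ ^ 2),
    integral_norm_sq_complexGaussian hw.le, ← hs]
  have h3 : (s + w) / w = 1 + s / w := by field_simp; ring
  simp [div_self hw.ne', div_self hu.ne', h3]

lemma mutualInfoBits_gaussianChannelLaw_le [StandardBorelSpace X] (hm : Measurable m)
    (hm2 : MemLp m 2 P) {w : ℝ} (hw : 0 < w) :
    mutualInfoBits (gaussianChannelLaw P m w) ≤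
      ENNReal.ofReal (Real.logb 2 (1 + (∫ x, ‖m x‖ ^ 2 ∂P) / w)) := by
  have := gaussianChannelLaw_isProbabilityMeasure (P := P) hm w
  have : Nonempty X := nonempty_of_isProbabilityMeasure P
  have h := klDiv_fst_prod_snd_le (gaussianChannelLaw P m w)
    (complexGaussian (∫ x, ‖m x‖ ^ 2 ∂P + w))
  nth_rewrite 2 [gaussianChannelLaw_fst hm w] at h
  rw [klDiv_gaussianChannelLaw hm hm2 hw] at h
  rw [mutualInfoBits, Real.logb, ENNReal.ofReal_div_of_pos (Real.log_pos one_lt_two)]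
  exact ENNReal.div_le_div_right h _

/-- For a Gaussian input the output marginal is exactly the reference law, so nothing is lost. -/
lemma mutualInfoBits_gaussianChannelLaw_eq (hm : Measurable m) {s w : ℝ} (hs : 0 ≤ s)
    (hPm : P.map m = complexGaussian s) (hw : 0 < w) :
    mutualInfoBits (gaussianChannelLaw P m w) =
      ENNReal.ofReal (Real.logb 2 (1 + s / w)) := by
  have hm2 : MemLp m 2 P := by
    have h := memLp_id_complexGaussian s
    rw [← hPm, memLp_map_measure_iff (by fun_prop) hm.aemeasurable] at h
    exact h
  have hI : ∫ x, ‖m x‖ ^ 2 ∂P = s := by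
    have h := integral_norm_sq_complexGaussian hs
    rwa [← hPm, integral_map hm.aemeasurable (by fun_prop)] at h
  have hsnd : (gaussianChannelLaw P m w).snd = complexGaussian (s + w) := by
    rw [← complexGaussian_prod_map_add hs hw.le, ← hPm, gaussianChannelLaw, Measure.snd,
      Measure.map_map (by fun_prop) (by fun_prop)]
    have : (P.map m).prod (complexGaussian w) =
        (P.prod (complexGaussian w)).map (Prod.map m id) := by
      rw [← Measure.map_prod_map _ _ hm measurable_id, Measure.map_id]
    rw [this, Measure.map_map (by fun_prop) (by fun_prop)]
    rfl
  rw [mutualInfoBits, gaussianChannelLaw_fst hm, hsnd, Real.logb,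
    ENNReal.ofReal_div_of_pos (Real.log_pos one_lt_two)]
  have := klDiv_gaussianChannelLaw hm hm2 hw
  rw [hI] at this
  rw [this]

end GaussianChannel

/-! ### The downlink as a Gaussian channel. -/

/-- The mean power `E|hᴴ x|²` of the received signal. -/
noncomputable def receivedPower {M : ℕ} (h : Fin M → ℂ) (P : Measure (Fin M → ℂ)) : ℝ :=
  ∫ x, ‖star h ⬝ᵥ x‖ ^ 2 ∂P

/-- The sum `∑ᵢ |hᵢ|² E|xᵢ|²` of the mean powers received from the single antennas. -/
noncomputable def antennaPower {M : ℕ} (h : Fin M → ℂ) (P : Measure (Fin M → ℂ)) : ℝ :=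
  ∑ i, ‖h i‖ ^ 2 * ∫ x, ‖x i‖ ^ 2 ∂P

/-- The total variance of distortion and noise at the user. -/
noncomputable def noiseVariance {M : ℕ} (κb κu σ : ℝ) (h : Fin M → ℂ)
    (P : Measure (Fin M → ℂ)) : ℝ :=
  κb * antennaPower h P + κu * (receivedPower h P + κb * antennaPower h P) + σ ^ 2

section

variable {M : ℕ} {P : Measure (Fin M → ℂ)}

lemma receivedPower_nonneg (h : Fin M → ℂ) : 0 ≤ receivedPower h P :=
  integral_nonneg fun _ => by positivity

lemma antennaPower_nonneg (h : Fin M → ℂ) : 0 ≤ antennaPower h P :=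
  Finset.sum_nonneg fun _ _ => mul_nonneg (by positivity) (integral_nonneg fun _ => by positivity)

lemma measurable_star_dotProduct (h : Fin M → ℂ) :
    Measurable fun x : Fin M → ℂ => star h ⬝ᵥ x := by
  unfold dotProduct; fun_prop

lemma IsSignalLaw.memLp {p : ℝ} (hP : IsSignalLaw p P) (i : Fin M) :
    MemLp (fun x => x i) 2 P := by
  refine ⟨(measurable_pi_apply i).aestronglyMeasurable, ?_⟩
  rw [eLpNorm_lt_top_iff_lintegral_rpow_enorm_lt_top two_ne_zero ENNReal.ofNat_ne_top]
  refine lt_of_le_of_lt ?_ (ENNReal.ofReal_lt_top (r := p))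
  rw [← hP.2]
  refine lintegral_mono fun x => ?_
  simp only [ENNReal.toReal_ofNat, ENNReal.rpow_ofNat]
  exact Finset.single_le_sum (f := fun i => ‖x i‖ₑ ^ 2) (fun _ _ => zero_le) (Finset.mem_univ i)

lemma memLp_star_dotProduct (hP : ∀ i, MemLp (fun x => x i) 2 P) (h : Fin M → ℂ) :
    MemLp (fun x => star h ⬝ᵥ x) 2 P := by
  unfold dotProduct
  exact memLp_finsetSum _ fun i _ => (hP i).const_mul _

lemma signalMatrix_diag (i : Fin M) : signalMatrix P i i = ((∫ x, ‖x i‖ ^ 2 ∂P : ℝ) : ℂ) := by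
  rw [signalMatrix, ← integral_complex_ofReal]
  congr 1 with x
  rw [Complex.star_def, Complex.mul_conj, Complex.normSq_eq_norm_sq]

lemma distortionMatrix_diag (κb : ℝ) (i : Fin M) :
    distortionMatrix κb P i i = ((κb * ∫ x, ‖x i‖ ^ 2 ∂P : ℝ) : ℂ) := by
  simp [distortionMatrix, signalMatrix_diag]

lemma star_dotProduct_signalMatrix_mulVec (hP : ∀ i, MemLp (fun x => x i) 2 P) (h : Fin M → ℂ) :
    star h ⬝ᵥ (signalMatrix P).mulVec h = (receivedPower h P : ℂ) := by
  have hint : ∀ i k, Integrable (fun x : Fin M → ℂ => x i * star (x k)) P := fun i k =>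
    (hP i).integrable_mul (hP k).star
  rw [receivedPower, ← integral_complex_ofReal]
  have hx : ∀ x : Fin M → ℂ, ((‖star h ⬝ᵥ x‖ ^ 2 : ℝ) : ℂ) =
      ∑ i, ∑ k, star (h i) * (x i * star (x k) * h k) := by
    intro x
    rw [← Complex.normSq_eq_norm_sq, ← Complex.mul_conj, dotProduct, map_sum,
      Finset.sum_mul_sum]
    refine Finset.sum_congr rfl fun i _ => Finset.sum_congr rfl fun k _ => ?_
    simp
    ring
  simp_rw [hx]
  rw [integral_finsetSum _ fun i _ => integrable_finsetSum _ fun k _ =>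
    ((hint i k).mul_const _).const_mul _]
  simp only [dotProduct, Matrix.mulVec, Pi.star_apply, Finset.mul_sum]
  refine Finset.sum_congr rfl fun i _ => ?_
  rw [integral_finsetSum _ fun k _ => ((hint i k).mul_const _).const_mul _]
  refine Finset.sum_congr rfl fun k _ => ?_
  rw [integral_const_mul, integral_mul_const, signalMatrix]

lemma distortionVariance_eq (κb κu : ℝ) (hP : ∀ i, MemLp (fun x => x i) 2 P) (h : Fin M → ℂ) :
    distortionVariance κb κu h P = κu * (receivedPower h P + κb * antennaPower h P) := by
  rw [distortionVariance, Matrix.add_mulVec, dotProduct_add,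
    star_dotProduct_signalMatrix_mulVec hP]
  have : star h ⬝ᵥ (distortionMatrix κb P).mulVec h = ((κb * antennaPower h P : ℝ) : ℂ) := by
    rw [antennaPower, distortionMatrix, Matrix.smul_mulVec, dotProduct_smul, dotProduct]
    simp only [Matrix.mulVec_diagonal, signalMatrix_diag, Pi.star_apply, smul_eq_mul]
    push_cast
    congr 1
    refine Finset.sum_congr rfl fun i _ => ?_
    rw [← Complex.ofReal_pow, ← Complex.normSq_eq_norm_sq, ← Complex.mul_conj]
    simp only [Complex.star_def]
    ring
  rw [this, Complex.add_re, Complex.ofReal_re, Complex.ofReal_re]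

/-- The antenna distortion projected on `h` is Gaussian of variance `κb * antennaPower h P`; adding
the two independent scalar noises keeps it Gaussian. -/
lemma downlinkLaw_eq_gaussianChannelLaw [IsProbabilityMeasure P] {κb κu : ℝ} (hκb : 0 ≤ κb)
    (hκu : 0 ≤ κu) (σ : ℝ) (hP : ∀ i, MemLp (fun x => x i) 2 P) (h : Fin M → ℂ) :
    downlinkLaw κb κu σ h P =
      gaussianChannelLaw P (fun x => star h ⬝ᵥ x) (noiseVariance κb κu σ h P) := by
  have hs := receivedPower_nonneg (P := P) h
  have hd := antennaPower_nonneg (P := P) h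
  have hv : ∀ i, 0 ≤ (distortionMatrix κb P i i).re := fun i => by
    rw [distortionMatrix_diag, Complex.ofReal_re]
    exact mul_nonneg hκb (integral_nonneg fun _ => by positivity)
  have hη : (complexGaussianVec fun i => (distortionMatrix κb P i i).re).map
      (fun η => star h ⬝ᵥ η) = complexGaussian (κb * antennaPower h P) := by
    have := complexGaussianVec_map_sum hv (star h)
    unfold dotProduct
    rw [this, antennaPower, Finset.mul_sum]
    congr 1
    refine Finset.sum_congr rfl fun i _ => ?_
    rw [distortionMatrix_diag, Complex.ofReal_re, Pi.star_apply, norm_star]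
    ring
  have hmd := measurable_star_dotProduct h
  have hnoise : ((complexGaussianVec fun i => (distortionMatrix κb P i i).re).prod
      ((complexGaussian (distortionVariance κb κu h P)).prod (complexGaussian (σ ^ 2)))).map
      (fun t => star h ⬝ᵥ t.1 + (t.2.1 + t.2.2)) =
      complexGaussian (noiseVariance κb κu σ h P) := by
    rw [noiseVariance, add_assoc, ← complexGaussian_prod_map_add (by positivity) (by positivity),
      ← complexGaussian_prod_map_add (by positivity) (by positivity), ← hη,
      distortionVariance_eq κb κu hP h, Measure.map_prod_map _ _ hmd (by fun_prop),
      Measure.map_map (by fun_prop) (by fun_prop)]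
    rfl
  rw [downlinkLaw, gaussianChannelLaw, ← hnoise]
  conv_rhs => enter [2, 1]; rw [← Measure.map_id (μ := P)]
  rw [Measure.map_prod_map _ _ measurable_id (by fun_prop),
    Measure.map_map (by fun_prop) (by fun_prop)]
  congr 1
  funext t
  simp only [Function.comp, Prod.map, id, dotProduct_add]
  congr 1
  ring

/-- The user's own distortion already contributes `κu` times the received power to the noise. -/
lemma mutualInfoBits_downlinkLaw_le {κb κu σ p : ℝ} (hκb : 0 ≤ κb) (hκu : 0 < κu) (hσ : 0 < σ)
    (hP : IsSignalLaw p P) (h : Fin M → ℂ) :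
    mutualInfoBits (downlinkLaw κb κu σ h P) ≤ ENNReal.ofReal (Real.logb 2 (1 + 1 / κu)) := by
  have := hP.1
  have hs := receivedPower_nonneg (P := P) h
  have hd := antennaPower_nonneg (P := P) h
  have hw : 0 < noiseVariance κb κu σ h P := by unfold noiseVariance; positivity
  rw [downlinkLaw_eq_gaussianChannelLaw hκb hκu.le σ hP.memLp h]
  refine (mutualInfoBits_gaussianChannelLaw_le (measurable_star_dotProduct h)
    (memLp_star_dotProduct hP.memLp h) hw).trans (ENNReal.ofReal_le_ofReal ?_)
  have hle : (∫ x, ‖star h ⬝ᵥ x‖ ^ 2 ∂P) / noiseVariance κb κu σ h P ≤ 1 / κu := by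
    rw [← receivedPower, div_le_div_iff₀ hw hκu, noiseVariance]
    have : 0 ≤ κb * antennaPower h P + κu * (κb * antennaPower h P) + σ ^ 2 := by positivity
    linarith
  have h0 : 0 ≤ (∫ x, ‖star h ⬝ᵥ x‖ ^ 2 ∂P) / noiseVariance κb κu σ h P := div_nonneg hs hw.le
  exact Real.logb_le_logb_of_le one_lt_two (by linarith) (by linarith)

end

/-! ### Gaussian beams and the information they carry. -/

/-- The law of the Gaussian signal `a z`, `z ~ CN(0, p)`, sent in the direction `a`. -/
noncomputable def beamLaw {M : ℕ} (p : ℝ) (a : Fin M → ℂ) : Measure (Fin M → ℂ) :=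
  (complexGaussian p).map fun z i => a i * z

section

variable {M : ℕ} {p : ℝ}

instance (p : ℝ) (a : Fin M → ℂ) : IsProbabilityMeasure (beamLaw p a) :=
  Measure.isProbabilityMeasure_map (by fun_prop)

lemma isSignalLaw_beamLaw (hp : 0 ≤ p) {a : Fin M → ℂ} (ha : ∑ i, ‖a i‖ ^ 2 = 1) :
    IsSignalLaw p (beamLaw p a) := by
  refine ⟨inferInstance, ?_⟩
  rw [beamLaw, lintegral_map (by fun_prop) (by fun_prop)]
  have h : ∀ z : ℂ, ∑ i, ‖a i * z‖ₑ ^ 2 = ENNReal.ofReal (‖z‖ ^ 2) := by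
    intro z
    rw [← one_mul (‖z‖ ^ 2), ← ha, Finset.sum_mul,
      ENNReal.ofReal_sum_of_nonneg fun _ _ => by positivity]
    refine Finset.sum_congr rfl fun i _ => ?_
    rw [← mul_pow, ← norm_mul, ENNReal.ofReal_pow (norm_nonneg _), ofReal_norm]
  simp_rw [h]
  rw [← ofReal_integral_eq_lintegral_ofReal (integrable_norm_sq_complexGaussian p)
    (ae_of_all _ fun _ => by positivity), integral_norm_sq_complexGaussian hp]

lemma beamLaw_map_star_dotProduct (hp : 0 ≤ p) (a h : Fin M → ℂ) :
    (beamLaw p a).map (fun x => star h ⬝ᵥ x) = complexGaussian (‖star h ⬝ᵥ a‖ ^ 2 * p) := by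
  rw [beamLaw, Measure.map_map (measurable_star_dotProduct h) (by fun_prop),
    ← complexGaussian_map_const_mul hp]
  congr 1
  funext z
  simp only [Function.comp, dotProduct, Finset.sum_mul, mul_assoc]

lemma receivedPower_beamLaw (hp : 0 ≤ p) (a h : Fin M → ℂ) :
    receivedPower h (beamLaw p a) = ‖star h ⬝ᵥ a‖ ^ 2 * p := by
  rw [← integral_norm_sq_complexGaussian (mul_nonneg (sq_nonneg ‖star h ⬝ᵥ a‖) hp),
    ← beamLaw_map_star_dotProduct hp, integral_map (measurable_star_dotProduct h).aemeasurable
    (by fun_prop), receivedPower]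

lemma antennaPower_beamLaw (hp : 0 ≤ p) (a h : Fin M → ℂ) :
    antennaPower h (beamLaw p a) = (∑ i, ‖h i‖ ^ 2 * ‖a i‖ ^ 2) * p := by
  rw [antennaPower, Finset.sum_mul]
  refine Finset.sum_congr rfl fun i _ => ?_
  rw [beamLaw, integral_map (by fun_prop)
    ((measurable_pi_apply i).norm.pow_const 2).aestronglyMeasurable, mul_assoc]
  simp_rw [norm_mul, mul_pow]
  rw [integral_const_mul, integral_norm_sq_complexGaussian hp]

/-- A lower bound of the information sent through `K` antennas, each with channel gain at least
`R`. -/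
noncomputable def beamRate (κb κu σ p : ℝ) (K : ℕ) (R : ℝ) : ℝ :=
  Real.logb 2 (1 + 1 / (κu + κb * (1 + κu) / K + σ ^ 2 / (p * K * R ^ 2)))

/-- In the noise-to-signal ratio, `hd` divides the antenna distortion by `K`, and `hs` controls the
receiver noise. -/
lemma le_mutualInfoBits_beamLaw {κb κu σ : ℝ} (hκb : 0 ≤ κb) (hκu : 0 < κu) (hσ : 0 < σ)
    (hp : 0 < p) {a h : Fin M → ℂ} (ha : ∑ i, ‖a i‖ ^ 2 = 1) {K : ℕ} (hK : 0 < K) {R : ℝ}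
    (hR : 0 < R) (hd : K * ∑ i, ‖h i‖ ^ 2 * ‖a i‖ ^ 2 ≤ ‖star h ⬝ᵥ a‖ ^ 2)
    (hs : K * R ^ 2 ≤ ‖star h ⬝ᵥ a‖ ^ 2) :
    ENNReal.ofReal (beamRate κb κu σ p K R) ≤
      mutualInfoBits (downlinkLaw κb κu σ h (beamLaw p a)) := by
  have hP := isSignalLaw_beamLaw hp.le ha
  have hs0 := receivedPower_nonneg (P := beamLaw p a) h
  have hd0 := antennaPower_nonneg (P := beamLaw p a) h
  have hw : 0 < noiseVariance κb κu σ h (beamLaw p a) := by unfold noiseVariance; positivity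
  rw [downlinkLaw_eq_gaussianChannelLaw hκb hκu.le σ hP.memLp h,
    mutualInfoBits_gaussianChannelLaw_eq (measurable_star_dotProduct h) (by positivity)
      (beamLaw_map_star_dotProduct hp.le a h) hw]
  refine ENNReal.ofReal_le_ofReal ?_
  have hK' : (0 : ℝ) < K := by exact_mod_cast hK
  rw [beamRate]
  refine Real.logb_le_logb_of_le one_lt_two (by positivity) (add_le_add_right ?_ 1)
  rw [noiseVariance, receivedPower_beamLaw hp.le, antennaPower_beamLaw hp.le] at *
  set s := ‖star h ⬝ᵥ a‖ ^ 2
  set d := ∑ i, ‖h i‖ ^ 2 * ‖a i‖ ^ 2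
  have hspos : 0 < s := lt_of_lt_of_le (by positivity) hs
  rw [div_le_div_iff₀ (by positivity) hw, one_mul]
  have h1 : d * p ≤ s * p * (1 / K) := by
    rw [mul_one_div, le_div_iff₀ hK']
    nlinarith
  have h2 : σ ^ 2 ≤ s * p * (σ ^ 2 / (p * K * R ^ 2)) := by
    rw [mul_div_assoc', le_div_iff₀ (by positivity)]
    have := mul_le_mul_of_nonneg_left hs (by positivity : 0 ≤ σ ^ 2 * p)
    nlinarith
  have h3 := mul_le_mul_of_nonneg_left h1 (by positivity : 0 ≤ κb * (1 + κu))
  have h4 : s * p * (κu + κb * (1 + κu) / K + σ ^ 2 / (p * K * R ^ 2)) =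
      κu * (s * p) + κb * (1 + κu) * (s * p * (1 / K)) + s * p * (σ ^ 2 / (p * K * R ^ 2)) := by
    ring
  rw [h4]
  linarith

end

/-! ### Antenna gains under Rayleigh fading. -/

section

variable {M N : ℕ}

lemma measurable_overallChannel (θ : Fin N → ℝ) :
    Measurable fun c : ChannelState M N => overallChannel c θ := by
  refine measurable_pi_lambda _ fun i => ?_
  simp only [overallChannel, Pi.add_apply, Matrix.mulVec, dotProduct, Matrix.mul_diagonal,
    Matrix.of_apply]
  fun_prop

lemma overallChannel_apply (c : ChannelState M N) (θ : Fin N → ℝ) (i : Fin M) :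
    overallChannel c θ i = c.1 i + ∑ j,
      (Complex.exp (Complex.I * ((θ j + c.2.2.2 j : ℝ) : ℂ)) * c.2.2.1 j) * c.2.1 i j := by
  simp only [overallChannel, Pi.add_apply, Matrix.mulVec, dotProduct, Matrix.mul_diagonal,
    Matrix.of_apply]
  congr 1
  exact Finset.sum_congr rfl fun j _ => by ring

lemma pi_complexGaussianVec_sum_ball_le {βg : ℝ} (hβg : 0 < βg) (i : Fin M) (b : ℂ)
    (u : Fin N → ℂ) {R L : ℝ} (hR : 0 < R) (hL : 0 < L) (hu : ∃ j, L ≤ ‖u j‖) :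
    (Measure.pi fun _ : Fin M => complexGaussianVec fun _ : Fin N => βg)
      {G | ‖b + ∑ j, u j * G i j‖ < R} ≤ ENNReal.ofReal (R ^ 2 / (L ^ 2 * βg)) := by
  obtain ⟨j, hj⟩ := hu
  have hsum : L ^ 2 * βg ≤ ∑ j, ‖u j‖ ^ 2 * βg := by
    refine le_trans ?_ (Finset.single_le_sum (f := fun j => ‖u j‖ ^ 2 * βg)
      (fun _ _ => by positivity) (Finset.mem_univ j))
    gcongr
  have hpos : 0 < ∑ j, ‖u j‖ ^ 2 * βg := lt_of_lt_of_le (by positivity) hsum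
  have hlaw : (Measure.pi fun _ : Fin M => complexGaussianVec fun _ : Fin N => βg).map
      (fun G => ∑ j, u j * G i j) = complexGaussian (∑ j, ‖u j‖ ^ 2 * βg) := by
    have heval := (measurePreserving_eval
      (fun _ : Fin M => complexGaussianVec fun _ : Fin N => βg) i).map_eq
    have hsum := complexGaussianVec_map_sum (fun _ : Fin N => hβg.le) u
    rw [← heval, Measure.map_map (by fun_prop) (by fun_prop)] at hsum
    exact hsum
  have hset : {G : Fin M → Fin N → ℂ | ‖b + ∑ j, u j * G i j‖ < R} =
      (fun G => ∑ j, u j * G i j) ⁻¹' Metric.ball (-b) R := by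
    ext G
    simp [dist_eq_norm, add_comm]
  rw [hset, ← Measure.map_apply (by fun_prop) measurableSet_ball, hlaw]
  refine (complexGaussian_ball_le hpos _ hR.le).trans (ENNReal.ofReal_le_ofReal ?_)
  gcongr

/-- Either all entries of `h_r` are below `L`, which is the second term, or one is not and the
randomness of `G` alone makes a small gain unlikely. -/
lemma rayleighLaw_norm_lt_le {βd βg βh : ℝ} (hβg : 0 < βg) (ν : Measure (Fin N → ℝ))
    [IsProbabilityMeasure ν] (θ : Fin N → ℝ) (i : Fin M) {R L : ℝ} (hR : 0 < R) (hL : 0 < L) :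
    rayleighLaw M N βd βg βh ν {c | ‖overallChannel c θ i‖ < R} ≤
      ENNReal.ofReal (R ^ 2 / (L ^ 2 * βg)) + complexGaussian βh (Metric.ball 0 L) ^ N := by
  have hmeas : MeasurableSet {c : ChannelState M N | ‖overallChannel c θ i‖ < R} :=
    measurableSet_lt ((measurable_pi_apply i).comp (measurable_overallChannel θ)).norm
      measurable_const
  set B : Set ((Fin N → ℂ) × (Fin N → ℝ)) :=
    (Set.univ.pi fun _ => Metric.ball 0 L) ×ˢ Set.univ with hB
  have hBmeas : MeasurableSet B :=
    (MeasurableSet.univ_pi fun _ => measurableSet_ball).prod MeasurableSet.univ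
  have hBval : ((complexGaussianVec fun _ : Fin N => βh).prod ν) B =
      complexGaussian βh (Metric.ball 0 L) ^ N := by
    rw [hB, Measure.prod_prod, complexGaussianVec, Measure.pi_pi]
    simp
  rw [rayleighLaw, Measure.prod_apply hmeas]
  -- The bound is uniform in the direct channel `b`, which only shifts the centre of the ball.
  refine (lintegral_mono (g := fun _ => ENNReal.ofReal (R ^ 2 / (L ^ 2 * βg)) +
    complexGaussian βh (Metric.ball 0 L) ^ N) fun b => ?_).trans (by simp)
  rw [Measure.prod_apply_symm (measurable_prodMk_left hmeas)]
  refine (lintegral_mono (g := fun r => ENNReal.ofReal (R ^ 2 / (L ^ 2 * βg)) +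
    B.indicator 1 r) fun r => ?_).trans ?_
  · beta_reduce
    by_cases hr : r ∈ B
    · rw [Set.indicator_of_mem hr]
      exact prob_le_one.trans le_add_self
    · rw [Set.indicator_of_notMem hr, add_zero]
      have hex : ∃ j, L ≤ ‖Complex.exp (Complex.I * ((θ j + r.2 j : ℝ) : ℂ)) * r.1 j‖ := by
        by_contra! hcon
        refine hr ⟨fun j _ => ?_, trivial⟩
        have := hcon j
        -- Phase shifts and phase errors have modulus one, so the joint law `ν` plays no role.
        rwa [norm_mul, mul_comm Complex.I, Complex.norm_exp_ofReal_mul_I, one_mul,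
          ← mem_ball_zero_iff] at this
      refine le_trans (le_of_eq ?_) (pi_complexGaussianVec_sum_ball_le hβg i (b i) _ hR hL hex)
      congr 1
      ext G
      simp only [Set.mem_preimage, Set.mem_ofPred_eq, overallChannel_apply]
  · rw [lintegral_add_left measurable_const, lintegral_indicator_one hBmeas, hBval]
    simp

end

/-- First `L` is taken large for the `G` term, then `N` large for the `h_r` term. Neither choice
involves `M`. -/
lemma eventually_rayleighLaw_norm_lt_le {βd βg βh : ℝ} (hβg : 0 < βg) (hβh : 0 < βh)
    {ν : (N : ℕ) → Measure (Fin N → ℝ)} (hν : ∀ N, IsProbabilityMeasure (ν N)) {R : ℝ}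
    (hR : 0 < R) {ε : ENNReal} (hε : 0 < ε) :
    ∀ᶠ N in atTop, ∀ (M : ℕ) (i : Fin M),
      rayleighLaw M N βd βg βh (ν N) {c | ‖overallChannel c 0 i‖ < R} ≤ ε := by
  have hε2 : 0 < ε / 2 := ENNReal.half_pos hε.ne'
  have h1 : Tendsto (fun L : ℝ => ENNReal.ofReal (R ^ 2 / (L ^ 2 * βg))) atTop (𝓝 0) := by
    rw [← ENNReal.ofReal_zero]
    refine ENNReal.tendsto_ofReal (Tendsto.const_div_atTop ?_ _)
    exact (tendsto_pow_atTop two_ne_zero).atTop_mul_const hβg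
  obtain ⟨L, hL1, hL⟩ := ((h1.eventually (gt_mem_nhds hε2)).and (eventually_gt_atTop 0)).exists
  have h2 : Tendsto (fun N : ℕ => complexGaussian βh (Metric.ball 0 L) ^ N) atTop (𝓝 0) :=
    ENNReal.tendsto_pow_atTop_nhds_zero_of_lt_one (complexGaussian_ball_lt_one hβh L)
  filter_upwards [h2.eventually (gt_mem_nhds hε2)] with N hN M i
  have := hν N
  exact (rayleighLaw_norm_lt_le hβg (ν N) 0 i hR hL).trans
    ((add_le_add hL1.le hN.le).trans (ENNReal.add_halves ε).le)

/-- The channel states for which, with all phase shifts zero, the first `K` antennas have channel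
gain at least `R`. -/
def strongStates (M N K : ℕ) (R : ℝ) : Set (ChannelState M N) :=
  {c | ∀ i : Fin M, i.val < K → R ≤ ‖overallChannel c 0 i‖}

lemma measurableSet_strongStates (M N K : ℕ) (R : ℝ) : MeasurableSet (strongStates M N K R) := by
  have : strongStates M N K R =
      ⋂ i : Fin M, ⋂ _ : i.val < K, {c | R ≤ ‖overallChannel c 0 i‖} := by
    ext c; simp [strongStates]
  rw [this]
  exact MeasurableSet.iInter fun i => MeasurableSet.iInter fun _ =>
    measurableSet_le measurable_const
      ((measurable_pi_apply i).comp (measurable_overallChannel 0)).norm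

lemma tendsto_rayleighLaw_strongStates {βd βg βh : ℝ} (hβg : 0 < βg) (hβh : 0 < βh)
    {ν : (N : ℕ) → Measure (Fin N → ℝ)} (hν : ∀ N, IsProbabilityMeasure (ν N)) (K : ℕ) {R : ℝ}
    (hR : 0 < R) :
    Tendsto (fun q : ℕ × ℕ => rayleighLaw q.1 q.2 βd βg βh (ν q.2) (strongStates q.1 q.2 K R))
      atTop (𝓝 1) := by
  have hprob : ∀ q : ℕ × ℕ, IsProbabilityMeasure (rayleighLaw q.1 q.2 βd βg βh (ν q.2)) := by
    intro q
    have := hν q.2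
    unfold rayleighLaw
    infer_instance
  have hcompl : Tendsto (fun q : ℕ × ℕ =>
      rayleighLaw q.1 q.2 βd βg βh (ν q.2) (strongStates q.1 q.2 K R)ᶜ) atTop (𝓝 0) := by
    rw [ENNReal.tendsto_nhds_zero]
    intro ε hε
    -- Union bound over at most `K` antennas; `K + 1` avoids dividing by zero when `K = 0`.
    have hε' : 0 < ε / (K + 1 : ℕ) := ENNReal.div_pos hε.ne' (ENNReal.natCast_ne_top _)
    have h := eventually_rayleighLaw_norm_lt_le (βd := βd) hβg hβh hν hR hε'
    rw [← prod_atTop_atTop_eq]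
    filter_upwards [h.prod_inr atTop] with q hq
    have hsub : (strongStates q.1 q.2 K R)ᶜ ⊆ ⋃ i ∈ Finset.univ.filter fun i : Fin q.1 => i.val < K,
        {c | ‖overallChannel c 0 i‖ < R} := by
      intro c hc
      simp only [strongStates, Set.mem_compl_iff, Set.mem_ofPred_eq, not_forall, not_le] at hc
      obtain ⟨i, hi, hlt⟩ := hc
      simp only [Set.mem_iUnion]
      exact ⟨i, by simpa using hi, hlt⟩
    have hcard : (Finset.univ.filter fun i : Fin q.1 => i.val < K).card ≤ K + 1 := by
      refine (Finset.card_le_card_of_injOn (fun i : Fin q.1 => i.val) (t := Finset.range K)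
        (fun i hi => by simpa using hi) (Fin.val_injective.injOn)).trans ?_
      simp
    calc _ ≤ ∑ i ∈ Finset.univ.filter fun i : Fin q.1 => i.val < K,
          rayleighLaw q.1 q.2 βd βg βh (ν q.2) {c | ‖overallChannel c 0 i‖ < R} :=
          (measure_mono hsub).trans (measure_biUnion_finset_le _ _)
      _ ≤ (Finset.univ.filter fun i : Fin q.1 => i.val < K).card • (ε / (K + 1 : ℕ)) :=
          Finset.sum_le_card_nsmul _ _ _ fun i _ => hq q.1 i
      _ ≤ (K + 1 : ℕ) * (ε / (K + 1 : ℕ)) := by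
          rw [nsmul_eq_mul]
          gcongr
      _ = ε := ENNReal.mul_div_cancel (by simp) (ENNReal.natCast_ne_top _)
  have h1 := ENNReal.Tendsto.sub (tendsto_const_nhds (x := (1 : ENNReal))) hcompl (Or.inl (by simp))
  rw [tsub_zero] at h1
  refine h1.congr fun q => ?_
  have := hprob q
  rw [prob_compl_eq_one_sub (measurableSet_strongStates _ _ _ _),
    ENNReal.sub_sub_cancel ENNReal.one_ne_top prob_le_one]

/-- Weights proportional to the inverse of `star (h i)` on the first `K` antennas make all `K`
contributions to `star h ⬝ᵥ a` equal, the equality case of Cauchy–Schwarz. A matched filter would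
not equalize them. -/
lemma exists_unit_beam {M : ℕ} {h : Fin M → ℂ} {K : ℕ} (hK : 0 < K) (hKM : K ≤ M) {R : ℝ}
    (hR : 0 < R) (hh : ∀ i : Fin M, i.val < K → R ≤ ‖h i‖) :
    ∃ a : Fin M → ℂ, ∑ i, ‖a i‖ ^ 2 = 1 ∧
      K * ∑ i, ‖h i‖ ^ 2 * ‖a i‖ ^ 2 ≤ ‖star h ⬝ᵥ a‖ ^ 2 ∧ K * R ^ 2 ≤ ‖star h ⬝ᵥ a‖ ^ 2 := by
  set A : Finset (Fin M) := Finset.univ.filter fun i => i.val < K with hA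
  have hcard : A.card = K := by
    rw [hA, Fin.card_filter_val_lt, min_eq_right hKM]
  have hK' : (0 : ℝ) < K := by exact_mod_cast hK
  have hpos : ∀ i ∈ A, 0 < ‖h i‖ := fun i hi => hR.trans_le (hh i (by simpa [hA] using hi))
  -- The squared norm of the unnormalized inverse weights.
  set T : ℝ := ∑ i ∈ A, (‖h i‖ ^ 2)⁻¹ with hT
  have hTpos : 0 < T := by
    refine Finset.sum_pos (fun i hi => by have := hpos i hi; positivity) ?_
    rw [← Finset.card_pos, hcard]; exact hK
  have hTle : T ≤ K * (R ^ 2)⁻¹ := by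
    rw [← hcard, ← nsmul_eq_mul]
    refine Finset.sum_le_card_nsmul _ _ _ fun i hi => ?_
    have := hh i (by simpa [hA] using hi)
    gcongr
  have hsqrt : Real.sqrt T ^ 2 = T := Real.sq_sqrt hTpos.le
  set a : Fin M → ℂ := fun i => if i ∈ A then ((Real.sqrt T : ℝ) : ℂ)⁻¹ * (star (h i))⁻¹ else 0
    with ha
  have hsum : ∀ f : Fin M → ℝ, ∑ i, f i * ‖a i‖ ^ 2 = ∑ i ∈ A, f i * (T⁻¹ * (‖h i‖ ^ 2)⁻¹) := by
    intro f
    rw [← Finset.sum_subset (Finset.subset_univ A) fun i _ hi => by simp [ha, hi]]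
    refine Finset.sum_congr rfl fun i hi => ?_
    simp only [ha, hi, if_true, norm_mul, norm_inv, Complex.norm_real, norm_star, mul_pow, inv_pow,
      Real.norm_eq_abs, sq_abs, hsqrt]
  have hdot : star h ⬝ᵥ a = ((K * (Real.sqrt T)⁻¹ : ℝ) : ℂ) := by
    rw [dotProduct, ← Finset.sum_subset (Finset.subset_univ A) fun i _ hi => by simp [ha, hi],
      ← hcard]
    push_cast
    rw [← nsmul_eq_mul]
    refine Finset.sum_eq_card_nsmul fun i hi => ?_
    have : star (h i) ≠ 0 := star_ne_zero.2 (norm_pos_iff.1 (hpos i hi))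
    simp only [ha, hi, if_true, Pi.star_apply]
    field_simp
  have hnorm : ‖star h ⬝ᵥ a‖ ^ 2 = K ^ 2 * T⁻¹ := by
    rw [hdot, Complex.norm_real, Real.norm_eq_abs, sq_abs, mul_pow, inv_pow, hsqrt]
  refine ⟨a, ?_, ?_, ?_⟩
  · have := hsum fun _ => 1
    simp only [one_mul, ← Finset.mul_sum, ← hT] at this
    rw [this, inv_mul_cancel₀ hTpos.ne']
  · rw [hsum, hnorm, Finset.sum_congr rfl (g := fun _ => T⁻¹) fun i hi => by
      have := (hpos i hi).ne'
      field_simp]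
    rw [Finset.sum_const, hcard, nsmul_eq_mul]
    exact le_of_eq (by ring)
  · rw [hnorm, ← div_eq_mul_inv, le_div_iff₀ hTpos]
    calc (K : ℝ) * R ^ 2 * T ≤ (K : ℝ) * R ^ 2 * (K * (R ^ 2)⁻¹) := by gcongr
      _ = (K : ℝ) ^ 2 := by field_simp

/-! ### Limits of the achievable rates. -/

lemma tendsto_beamRate_gain {κb κu : ℝ} (σ : ℝ) {p : ℝ} (hκb : 0 ≤ κb) (hκu : 0 < κu)
    (hp : 0 < p) :
    Tendsto (fun R : ℝ => beamRate κb κu σ p 1 R) atTop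
      (𝓝 (Real.logb 2 (1 + 1 / (κb + κu * (1 + κb))))) := by
  have h0 : Tendsto (fun R : ℝ => σ ^ 2 / (p * (1 : ℕ) * R ^ 2)) atTop (𝓝 0) :=
    Tendsto.const_div_atTop
      ((tendsto_pow_atTop two_ne_zero).const_mul_atTop (by simpa using hp)) _
  have h1 := (h0.const_add (κu + κb * (1 + κu) / (1 : ℕ)))
  have hne : κu + κb * (1 + κu) / (1 : ℕ) + 0 ≠ 0 := by
    have : 0 < κu + κb * (1 + κu) / (1 : ℕ) + 0 := by positivity
    exact this.ne'
  have h2 := ((tendsto_const_nhds (x := (1 : ℝ))).div h1 hne).const_add 1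
  have hpos : (0 : ℝ) < 1 + 1 / (κu + κb * (1 + κu) / (1 : ℕ) + 0) := by positivity
  have h3 := (h2.log hpos.ne').div_const (Real.log 2)
  have heq : κb + κu * (1 + κb) = κu + κb * (1 + κu) / (1 : ℕ) + 0 := by push_cast; ring
  rw [heq]
  exact h3

lemma tendsto_beamRate_card (κb : ℝ) {κu : ℝ} (σ p : ℝ) (hκu : 0 < κu) :
    Tendsto (fun K : ℕ => beamRate κb κu σ p K 1) atTop (𝓝 (Real.logb 2 (1 + 1 / κu))) := by
  have h0 : Tendsto (fun K : ℕ => κb * (1 + κu) / (K : ℝ)) atTop (𝓝 0) :=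
    tendsto_const_div_atTop_nhds_zero_nat _
  have h0' : Tendsto (fun K : ℕ => σ ^ 2 / (p * K * (1 : ℝ) ^ 2)) atTop (𝓝 0) := by
    refine (tendsto_const_div_atTop_nhds_zero_nat (σ ^ 2 / p)).congr fun K => ?_
    rw [one_pow, mul_one, div_div]
  have h1 := (h0.const_add κu).add h0'
  rw [add_zero, add_zero] at h1
  have h2 := ((tendsto_const_nhds (x := (1 : ℝ))).div h1 hκu.ne').const_add 1
  have hpos : (0 : ℝ) < 1 + 1 / κu := by positivity
  exact (h2.log hpos.ne').div_const (Real.log 2)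

/-! ### Capacity bounds for finite `M` and `N`. -/

section

variable {M N : ℕ} {κb κu σ p τd τ : ℝ} {Ω S : Type*} [MeasurableSpace Ω] [MeasurableSpace S]
  {μ : Measure Ω} [IsProbabilityMeasure μ] {H : Ω → ChannelState M N} {Hb : Ω → S}

lemma downlinkCapacity_le (hκb : 0 ≤ κb) (hκu : 0 < κu) (hσ : 0 < σ) (hτ : 0 ≤ τd / τ)
    (hHb : Measurable Hb) :
    downlinkCapacity κb κu σ p τd τ μ H Hb ≤
      ENNReal.ofReal (τd / τ * Real.logb 2 (1 + 1 / κu)) := by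
  rw [downlinkCapacity, ENNReal.ofReal_mul hτ]
  gcongr
  have := Measure.isProbabilityMeasure_map hHb.aemeasurable (μ := μ)
  refine (lintegral_mono (g := fun _ => ENNReal.ofReal (Real.logb 2 (1 + 1 / κu)))
    fun s => ?_).trans (by simp)
  refine iSup₂_le fun P hP => iSup₂_le fun θ _ => ?_
  exact (lintegral_mono (g := fun _ => ENNReal.ofReal (Real.logb 2 (1 + 1 / κu))) fun c =>
    mutualInfoBits_downlinkLaw_le hκb hκu hσ hP _).trans (by simp)

/-- The same single-antenna beam is used whatever the value of `Hb`, so arbitrary CSI is allowed. -/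
lemma le_downlinkCapacity (hκb : 0 ≤ κb) (hκu : 0 < κu) (hσ : 0 < σ) (hp : 0 < p)
    (hH : Measurable H) (hHb : Measurable Hb) (hM : 1 ≤ M) {R : ℝ} (hR : 0 < R) :
    ENNReal.ofReal (τd / τ) *
        (ENNReal.ofReal (beamRate κb κu σ p 1 R) * μ.map H (strongStates M N 1 R)) ≤
      downlinkCapacity κb κu σ p τd τ μ H Hb := by
  have hG := measurableSet_strongStates M N 1 R
  set a : Fin M → ℂ := Pi.single ⟨0, hM⟩ 1 with ha
  have hsum : ∀ f : Fin M → ℝ, ∑ i, f i * ‖a i‖ ^ 2 = f ⟨0, hM⟩ := by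
    intro f
    rw [Finset.sum_eq_single ⟨0, hM⟩ (fun i _ hi => by simp [ha, hi]) (by simp)]
    simp [ha]
  have ha1 : ∑ i, ‖a i‖ ^ 2 = 1 := by simpa using hsum fun _ => 1
  -- Averaging the conditional probabilities over `Hb` restores the Rayleigh probability.
  have hint : ∫⁻ s, condDistrib H Hb μ s (strongStates M N 1 R) ∂(μ.map Hb) =
      μ.map H (strongStates M N 1 R) := by
    rw [← condDistrib_comp_map hHb.aemeasurable hH.aemeasurable,
      Measure.bind_apply hG (Kernel.aemeasurable _)]
  rw [downlinkCapacity, ← hint, ← lintegral_const_mul _ (Kernel.measurable_coe _ hG)]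
  gcongr with s
  refine le_iSup₂_of_le (beamLaw p a) (isSignalLaw_beamLaw hp.le ha1) <|
    le_iSup₂_of_le 0 (fun j => ⟨le_rfl, by simpa using Real.pi_pos.le⟩) ?_
  rw [← lintegral_indicator_const hG]
  refine lintegral_mono (Set.indicator_le fun c hc => ?_)
  have hdot : ‖star (overallChannel c 0) ⬝ᵥ a‖ = ‖overallChannel c 0 ⟨0, hM⟩‖ := by
    simp [ha]
  refine le_mutualInfoBits_beamLaw hκb hκu hσ hp ha1 one_pos hR ?_ ?_
  · rw [hsum, hdot]; simp
  · rw [hdot, Nat.cast_one, one_mul]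
    have : R ≤ ‖overallChannel c 0 ⟨0, hM⟩‖ := hc ⟨0, hM⟩ one_pos
    gcongr

/-- The conditional law of `H` is a Dirac mass at `g s`, so the beam may be fitted to the true
channel. The supremum is bounded separately at each `s`, so no measurable selection of beams is
needed. -/
lemma le_downlinkCapacity_of_perfect (hκb : 0 ≤ κb) (hκu : 0 < κu) (hσ : 0 < σ) (hp : 0 < p)
    (hHb : Measurable Hb) {g : S → ChannelState M N} (hg : Measurable g)
    (hHg : H = g ∘ Hb) {K : ℕ} (hK : 0 < K) (hKM : K ≤ M) {R : ℝ} (hR : 0 < R) :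
    ENNReal.ofReal (τd / τ) *
        (ENNReal.ofReal (beamRate κb κu σ p K R) * μ.map H (strongStates M N K R)) ≤
      downlinkCapacity κb κu σ p τd τ μ H Hb := by
  have hG := measurableSet_strongStates M N K R
  subst hHg
  rw [downlinkCapacity, ← Measure.map_map hg hHb, Measure.map_apply hg hG,
    ← lintegral_indicator_const (hg hG)]
  refine mul_le_mul_right (lintegral_mono_ae ?_) _
  filter_upwards [condDistrib_comp_self (μ := μ) Hb hg] with s hs
  rw [hs]
  by_cases hsG : g s ∈ strongStates M N K R
  · obtain ⟨a, ha1, hd, hr⟩ := exists_unit_beam hK hKM hR hsG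
    rw [Set.indicator_of_mem (show s ∈ g ⁻¹' strongStates M N K R from hsG)]
    refine le_iSup₂_of_le (beamLaw p a) (isSignalLaw_beamLaw hp.le ha1) <|
      le_iSup₂_of_le 0 (fun j => ⟨le_rfl, by simpa using Real.pi_pos.le⟩) ?_
    rw [Kernel.deterministic_apply, lintegral_dirac]
    exact le_mutualInfoBits_beamLaw hκb hκu hσ hp ha1 hK hR hd hr
  · rw [Set.indicator_of_notMem (show s ∉ g ⁻¹' strongStates M N K R from hsG)]
    exact zero_le

end

/-! ### Passage to the limit. -/

lemma mul_le_liminf_of_tendsto_one {α : Type*} {l : Filter α} [l.NeBot] {T r : ENNReal}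
    (hT : T ≠ ⊤) (hr : r ≠ ⊤) {m C : α → ENNReal} (hm : Tendsto m l (𝓝 1))
    (h : ∀ᶠ q in l, T * (r * m q) ≤ C q) : T * r ≤ liminf C l := by
  have h1 := ENNReal.Tendsto.const_mul (ENNReal.Tendsto.const_mul hm (Or.inr hr)) (Or.inr hT)
  rw [mul_one] at h1
  rw [← h1.liminf_eq]
  exact liminf_le_liminf h

theorem theorem4
    (κb κu σ p τd τ βd βg βh : ℝ)
    (hκb : 0 ≤ κb) (hκu : 0 < κu) (hσ : 0 < σ) (hp : 0 < p) (hτd : 0 < τd) (hτ : 0 < τ)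
    (hβd : 0 ≤ βd) (hβg : 0 < βg) (hβh : 0 < βh)
    (ν : (N : ℕ) → Measure (Fin N → ℝ)) (hν : ∀ N, IsProbabilityMeasure (ν N))
    {Ω : Type*} [MeasurableSpace Ω] (μ : Measure Ω) [IsProbabilityMeasure μ]
    (H : (M N : ℕ) → Ω → ChannelState M N) (hH : ∀ M N, Measurable (H M N))
    (hlaw : ∀ M N, μ.map (H M N) = rayleighLaw M N βd βg βh (ν N))
    {S : ℕ → ℕ → Type*} [∀ M N, MeasurableSpace (S M N)]
    (Hb : (M N : ℕ) → Ω → S M N) (hHb : ∀ M N, Measurable (Hb M N)) :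
    -- arbitrary channel knowledge `Hb` at the BS
    (ENNReal.ofReal (τd / τ * Real.logb 2 (1 + 1 / (κb + κu * (1 + κb)))) ≤
        liminf (fun q : ℕ × ℕ => downlinkCapacity κb κu σ p τd τ μ (H q.1 q.2) (Hb q.1 q.2))
          atTop ∧
      limsup (fun q : ℕ × ℕ => downlinkCapacity κb κu σ p τd τ μ (H q.1 q.2) (Hb q.1 q.2))
          atTop ≤
        ENNReal.ofReal (τd / τ * Real.logb 2 (1 + 1 / κu))) ∧
    -- perfect channel knowledge at the BS: the limit exists
    ((∀ M N, ∃ g : S M N → ChannelState M N, Measurable g ∧ H M N = g ∘ Hb M N) →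
      ∃ Cinf : ℝ,
        Tendsto
          (fun q : ℕ × ℕ => downlinkCapacity κb κu σ p τd τ μ (H q.1 q.2) (Hb q.1 q.2))
          atTop (𝓝 (ENNReal.ofReal Cinf)) ∧
        τd / τ * Real.logb 2 (1 + 1 / (κb + κu * (1 + κb))) ≤ Cinf ∧
        Cinf ≤ τd / τ * Real.logb 2 (1 + 1 / κu)) := by
  have hT : 0 ≤ τd / τ := by positivity
  have hup : ∀ q : ℕ × ℕ, downlinkCapacity κb κu σ p τd τ μ (H q.1 q.2) (Hb q.1 q.2) ≤
      ENNReal.ofReal (τd / τ * Real.logb 2 (1 + 1 / κu)) := fun q =>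
    downlinkCapacity_le hκb hκu hσ hT (hHb q.1 q.2)
  have hlimsup : limsup
      (fun q : ℕ × ℕ => downlinkCapacity κb κu σ p τd τ μ (H q.1 q.2) (Hb q.1 q.2)) atTop ≤
      ENNReal.ofReal (τd / τ * Real.logb 2 (1 + 1 / κu)) :=
    limsup_le_of_le (h := Eventually.of_forall hup)
  have hstrong : ∀ K : ℕ, ∀ R : ℝ, 0 < R → Tendsto
      (fun q : ℕ × ℕ => μ.map (H q.1 q.2) (strongStates q.1 q.2 K R)) atTop (𝓝 1) := by
    intro K R hR
    simp_rw [hlaw]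
    exact tendsto_rayleighLaw_strongStates hβg hβh hν K hR
  have hM : ∀ K : ℕ, ∀ᶠ q : ℕ × ℕ in atTop, K ≤ q.1 := fun K => by
    rw [← prod_atTop_atTop_eq]
    exact (eventually_ge_atTop K).prod_inl atTop
  refine ⟨⟨?_, hlimsup⟩, fun hperf => ⟨τd / τ * Real.logb 2 (1 + 1 / κu), ?_, ?_, le_rfl⟩⟩
  -- The threshold `R` goes to infinity only after `M` and `N`, which removes the receiver noise.
  · refine le_of_tendsto (f := fun R : ℝ => ENNReal.ofReal (τd / τ * beamRate κb κu σ p 1 R))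
      (ENNReal.tendsto_ofReal ((tendsto_beamRate_gain σ hκb hκu hp).const_mul _)) ?_
    filter_upwards [eventually_gt_atTop 0] with R hR
    rw [ENNReal.ofReal_mul hT]
    refine mul_le_liminf_of_tendsto_one ENNReal.ofReal_ne_top ENNReal.ofReal_ne_top
      (hstrong 1 R hR) ?_
    filter_upwards [hM 1] with q hq
    exact le_downlinkCapacity hκb hκu hσ hp (hH q.1 q.2) (hHb q.1 q.2) hq hR
  · refine tendsto_of_le_liminf_of_limsup_le ?_ hlimsup
    -- Here `R = 1` is enough: growing `K` removes both the antenna distortion and the receiver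
    -- noise.
    refine le_of_tendsto (f := fun K : ℕ => ENNReal.ofReal (τd / τ * beamRate κb κu σ p K 1))
      (ENNReal.tendsto_ofReal ((tendsto_beamRate_card κb σ p hκu).const_mul _)) ?_
    filter_upwards [eventually_gt_atTop 0] with K hK
    rw [ENNReal.ofReal_mul hT]
    refine mul_le_liminf_of_tendsto_one ENNReal.ofReal_ne_top ENNReal.ofReal_ne_top
      (hstrong K 1 one_pos) ?_
    filter_upwards [hM K] with q hq
    obtain ⟨g, hg, hHg⟩ := hperf q.1 q.2
    exact le_downlinkCapacity_of_perfect hκb hκu hσ hp (hHb q.1 q.2) hg hHg hK hq one_pos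
  · have : κu ≤ κb + κu * (1 + κb) := by nlinarith
    refine mul_le_mul_of_nonneg_left (Real.logb_le_logb_of_le one_lt_two (by positivity) ?_) hT
    gcongr
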